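/- **Theorem 2 (the optimal $u^2$ is the two-step-delayed centralized LQR).** Consider the linear system $x(k+1)=Ax(k)+Bu(k)+w(k)$, $k=0,\dots,N-1$, where $w$ is a zero-mean Gaussian white noise with covariance $W$ and $x(0)$ is square integrable, has zero mean and covariance $P_0$, and is independent of $w$. Let $Q_0,Q$ be (symmetric) positive semidefinite and $R$ (symmetric) positive definite, and let $$J=\mathbf E\{x(N)^TQ_0x(N)\}+\sum_{k=0}^{N-1}\mathbf E\{x(k)^TQx(k)+u(k)^TRu(k)\}.$$ Put $X(N)=Q_0$ and, for $k=N-1,\dots,0$, $$H(k)=B^TX(k+1)B+R,\qquad L(k)=-H(k)^{-1}B^TX(k+1)A,$$ $$X(k)=A^TX(k+1)A+Q-A^TX(k+1)B\,H(k)^{-1}B^TX(k+1)A .$$ Consider controls $u(k)=u^1(k)+u^2(k)$ with $u^1(k)=F(k)w(k-1)+M(k)w(k-2)$, where $w(-1)=x(0)$, $w(-2)=0$ and $F(k),M(k)$ are given matrices, and $u^2(k)=f_k(x(0:k-2))$, where $f_k$ is a linear function of the common information $x(0:k-2)=(x(0),\dots,x(k-2))$ (which is empty for $k=0,1$). Let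 $x^2(k)=\mathbf E\{x(k)\mid x(0:k-2)\}$ and $$J_u^2=\sum_{k=0}^{N-1}\mathbf E\{(u^2(k)-L(k)x^2(k))^TH(k)(u^2(k)-L(k)x^2(k))\}.$$ Then for every choice of $F$ and $M$ there are linear functions $f_k$ such that, almost surely, $$u^2(k)=L(k)x^2(k),\qquad k=0,\dots,N-1,$$ and every such control minimizes $J^2_u$ over all controls $u^2$ that are linear functions of $x(0:k-2)$ (with $F$ and $M$ fixed). It also minimizes the total cost $J$ over the same class; in particular (take $F=M=0$) $u(k)=L(k)\,\mathbf E\{x(k)\mid x(0:k-2)\}$ is the optimal controller of the centralized LQR problem in which all inputs are linear functions of $x(0:k-2)$. -/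

import Mathlib

open MeasureTheory ProbabilityTheory
open scoped Matrix

namespace DelayedLQR

noncomputable section

/-- The data of a finite-horizon linear quadratic problem: the dynamics
`x(k+1) = A x(k) + B u(k) + w(k)`, the weights `Q₀`, `Q`, `R` and the horizon `N`. -/
structure Plant (ι κ : Type*) where
  A : Matrix ι ι ℝ
  B : Matrix ι κ ℝ
  Q₀ : Matrix ι ι ℝ
  Q : Matrix ι ι ℝ
  R : Matrix κ κ ℝ
  N : ℕ

/-- Stochastic assumptions: `w` is a zero-mean Gaussian white noise (independent in time) with
covariance matrix `W`, and the initial state `x₀` is square integrable, has mean zero and covariance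
`P₀`, and is independent of the noise. -/
structure IsDisturbance {Ω ι : Type*} [MeasurableSpace Ω] [Fintype ι] (P : Measure Ω)
    (x₀ : Ω → ι → ℝ) (w : ℕ → Ω → ι → ℝ) (P₀ W : Matrix ι ι ℝ) : Prop where
  measurable_init : Measurable x₀
  memLp_init : MemLp x₀ 2 P
  mean_init : ∀ i, ∫ ω, x₀ ω i ∂P = 0
  cov_init : ∀ i j, ∫ ω, x₀ ω i * x₀ ω j ∂P = P₀ i j
  measurable_noise : ∀ k, Measurable (w k)
  gaussian_noise : ∀ k, HasGaussianLaw (w k) P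
  mean_noise : ∀ k i, ∫ ω, w k ω i ∂P = 0
  cov_noise : ∀ k i j, ∫ ω, w k ω i * w k ω j ∂P = W i j
  indep_noise : iIndepFun w P
  indep_init : IndepFun x₀ (fun ω k => w k ω) P

section Riccati

variable {ι κ : Type*} [Fintype ι] [Fintype κ] [DecidableEq κ]

/-- The Riccati iterate with `t` steps to go. -/
def riccati (S : Plant ι κ) : ℕ → Matrix ι ι ℝ
  | 0 => S.Q₀
  | t + 1 =>
      S.Aᵀ * riccati S t * S.A + S.Q
        - (S.Aᵀ * riccati S t * S.B) * (S.Bᵀ * riccati S t * S.B + S.R)⁻¹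
            * (S.Bᵀ * riccati S t * S.A)

/-- The Riccati matrix `X(k)`, for `k = 0, …, N`, with `X(N) = Q₀`. -/
def X (S : Plant ι κ) (k : ℕ) : Matrix ι ι ℝ := riccati S (S.N - k)

/-- `H(k) = Bᵀ X(k+1) B + R`. -/
def H (S : Plant ι κ) (k : ℕ) : Matrix κ κ ℝ := S.Bᵀ * X S (k + 1) * S.B + S.R

/-- The LQR gain `L(k) = -(Bᵀ X(k+1) B + R)⁻¹ Bᵀ X(k+1) A`; the optimal feedback is `u = L x`. -/
def L (S : Plant ι κ) (k : ℕ) : Matrix κ ι ℝ := -((H S k)⁻¹ * (S.Bᵀ * X S (k + 1) * S.A))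

end Riccati

/-- A family of linear functions of the common information `x(0), …, x(k-2)`
(of no variables at all for `k = 0, 1`). -/
abbrev CommonPolicy (ι κ : Type*) : Type _ :=
  (k : ℕ) → (Fin (k - 1) → ι → ℝ) →ₗ[ℝ] (κ → ℝ)

section ClosedLoop

variable {Ω ι κ : Type*} [Fintype ι] [Fintype κ]

/-- `w(k-1)`, with the convention `w(-1) = x(0)`. -/
def noise1 (x₀ : Ω → ι → ℝ) (w : ℕ → Ω → ι → ℝ) : ℕ → Ω → ι → ℝ
  | 0 => x₀
  | k + 1 => w k

/-- `w(k-2)`, with the conventions `w(-1) = x(0)` and `w(-2) = 0`. -/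
def noise2 (x₀ : Ω → ι → ℝ) (w : ℕ → Ω → ι → ℝ) : ℕ → Ω → ι → ℝ
  | 0 => 0
  | k + 1 => noise1 x₀ w k

/-- The local control component `u¹(k) = F(k) w(k-1) + M(k) w(k-2)`. -/
def u1 (x₀ : Ω → ι → ℝ) (w : ℕ → Ω → ι → ℝ) (F M : ℕ → Matrix κ ι ℝ) (k : ℕ) (ω : Ω) : κ → ℝ :=
  F k *ᵥ noise1 x₀ w k ω + M k *ᵥ noise2 x₀ w k ω

/-- The state of the closed loop `x(k+1) = A x(k) + B (u¹(k) + f_k(x(0:k-2))) + w(k)`. -/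
def state (S : Plant ι κ) (x₀ : Ω → ι → ℝ) (w : ℕ → Ω → ι → ℝ) (F M : ℕ → Matrix κ ι ℝ)
    (f : CommonPolicy ι κ) : ℕ → Ω → ι → ℝ
  | 0 => x₀
  | k + 1 => fun ω =>
      S.A *ᵥ state S x₀ w F M f k ω
        + S.B *ᵥ (u1 x₀ w F M k ω
            + f k (fun j : Fin (k - 1) => state S x₀ w F M f j.1 ω))
        + w k ω
  termination_by k => k
  decreasing_by
    all_goals omega

/-- The common component `u²(k) = f_k(x(0:k-2))`. -/
def u2 (S : Plant ι κ) (x₀ : Ω → ι → ℝ) (w : ℕ → Ω → ι → ℝ) (F M : ℕ → Matrix κ ι ℝ)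
    (f : CommonPolicy ι κ) (k : ℕ) (ω : Ω) : κ → ℝ :=
  f k (fun j : Fin (k - 1) => state S x₀ w F M f j.1 ω)

/-- The control input `u(k) = u¹(k) + u²(k)`. -/
def control (S : Plant ι κ) (x₀ : Ω → ι → ℝ) (w : ℕ → Ω → ι → ℝ) (F M : ℕ → Matrix κ ι ℝ)
    (f : CommonPolicy ι κ) (k : ℕ) (ω : Ω) : κ → ℝ :=
  u1 x₀ w F M k ω + u2 S x₀ w F M f k ω

/-- The recursion unfolds to the system equation. -/
theorem state_succ (S : Plant ι κ) (x₀ : Ω → ι → ℝ) (w : ℕ → Ω → ι → ℝ) (F M : ℕ → Matrix κ ι ℝ)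
    (f : CommonPolicy ι κ) (k : ℕ) (ω : Ω) :
    state S x₀ w F M f (k + 1) ω
      = S.A *ᵥ state S x₀ w F M f k ω + S.B *ᵥ control S x₀ w F M f k ω + w k ω := by
  rw [state]; rfl

/-- The σ-algebra generated by `x(0), …, x(k-2)` (trivial for `k = 0, 1`). -/
@[reducible] def commonInfo (x : ℕ → Ω → ι → ℝ) (k : ℕ) : MeasurableSpace Ω :=
  ⨆ j : Fin (k - 1), MeasurableSpace.comap (x j.1) inferInstance

/-- `x²(k) = E{x(k) | x(0:k-2)}`. -/
def x2 [MeasurableSpace Ω] (P : Measure Ω) (S : Plant ι κ) (x₀ : Ω → ι → ℝ)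
    (w : ℕ → Ω → ι → ℝ) (F M : ℕ → Matrix κ ι ℝ) (f : CommonPolicy ι κ) (k : ℕ) : Ω → ι → ℝ :=
  P[state S x₀ w F M f k | commonInfo (state S x₀ w F M f) k]

/-- The linear quadratic cost
`J = E{x(N)ᵀ Q₀ x(N)} + ∑_{k<N} E{x(k)ᵀ Q x(k) + u(k)ᵀ R u(k)}`. -/
def J [MeasurableSpace Ω] (P : Measure Ω) (S : Plant ι κ) (x₀ : Ω → ι → ℝ)
    (w : ℕ → Ω → ι → ℝ) (F M : ℕ → Matrix κ ι ℝ) (f : CommonPolicy ι κ) : ℝ :=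
  ∫ ω, state S x₀ w F M f S.N ω ⬝ᵥ (S.Q₀ *ᵥ state S x₀ w F M f S.N ω) ∂P
    + ∑ k ∈ Finset.range S.N,
        ∫ ω, (state S x₀ w F M f k ω ⬝ᵥ (S.Q *ᵥ state S x₀ w F M f k ω)
          + control S x₀ w F M f k ω ⬝ᵥ (S.R *ᵥ control S x₀ w F M f k ω)) ∂P

/-- The cost of the common component,
`J²_u = ∑_{k<N} E{(u²(k) - L(k) x²(k))ᵀ H(k) (u²(k) - L(k) x²(k))}`. -/
def J2 [DecidableEq κ] [MeasurableSpace Ω] (P : Measure Ω) (S : Plant ι κ) (x₀ : Ω → ι → ℝ)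
    (w : ℕ → Ω → ι → ℝ) (F M : ℕ → Matrix κ ι ℝ) (f : CommonPolicy ι κ) : ℝ :=
  ∑ k ∈ Finset.range S.N,
    ∫ ω, (u2 S x₀ w F M f k ω - L S k *ᵥ x2 P S x₀ w F M f k ω) ⬝ᵥ
      (H S k *ᵥ (u2 S x₀ w F M f k ω - L S k *ᵥ x2 P S x₀ w F M f k ω)) ∂P

end ClosedLoop

end

end DelayedLQR

/-! Put the innovations x(0), w(0), w(1), … into one sequence, `noise1`: they are independent,
centred and square integrable. Every closed-loop signal is a linear function of an initial segment
of them. The state splits as x(k) = `prediction` + `predictionError`. The first term is linear in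
x(0:k-2), hence in the innovations of index below k-1; the second uses only those of index k-1 and
k. Independence therefore gives x²(k) = `prediction` almost surely (`x2_ae_eq_prediction`), and the
error does not depend on the policy f. Completing the square along the Riccati recursion
(`stage_cost_eq`) turns J into an initial term, noise terms and the H-weighted squares of u - Lx.
Now u - Lx is the sum of u² - L·`prediction` and u¹ - L·`predictionError`, which are independent and
centred, so the cross term vanishes and J is a constant independent of f plus J²_u (`J_eq`). As J²_u
≥ 0, with value 0 when u² = Lx², both optimality claims follow. Such a policy exists by causality:
`prediction` at time k involves only f_i with i < k, so the f_k can be chosen one after another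
(`exists_policy_u2_eq`). -/

namespace DelayedLQR

/-! ### Quadratic forms and positivity of the input weight. -/

section QuadraticForms

variable {ι κ : Type*} [Fintype ι] [Fintype κ]

theorem mulVec_dotProduct (C : Matrix ι κ ℝ) (v : κ → ℝ) (z : ι → ℝ) :
    (C *ᵥ v) ⬝ᵥ z = v ⬝ᵥ (Cᵀ *ᵥ z) := by
  rw [Matrix.mulVec_transpose, dotProduct_comm v, ← Matrix.dotProduct_mulVec, dotProduct_comm]

theorem dotProduct_mulVec_symm {C : Matrix ι ι ℝ} (hC : Cᵀ = C) (v z : ι → ℝ) :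
    v ⬝ᵥ (C *ᵥ z) = z ⬝ᵥ (C *ᵥ v) := by
  rw [dotProduct_comm, mulVec_dotProduct, hC]

theorem dotProduct_mulVec_nonneg {C : Matrix κ κ ℝ} (hC : C.PosSemidef) (v : κ → ℝ) :
    0 ≤ v ⬝ᵥ (C *ᵥ v) := by
  simpa using hC.dotProduct_mulVec_nonneg v

theorem posDef_gain {S : Plant ι κ} (hR : S.R.PosDef) {Y : Matrix ι ι ℝ} (hY : Y.PosSemidef) :
    (S.Bᵀ * Y * S.B + S.R).PosDef := by
  have h := hY.conjTranspose_mul_mul_same S.B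
  rw [Matrix.conjTranspose_eq_transpose_of_trivial] at h
  exact Matrix.PosDef.posSemidef_add h hR

end QuadraticForms

/-! ### The Riccati recursion and completion of squares. -/

section Riccati

variable {ι κ : Type*} [Fintype ι] [Fintype κ] [DecidableEq κ]

/-- With K = G⁻¹BᵀYA, the iterate equals (A - BK)ᵀY(A - BK) + Q + KᵀRK, a sum of positive
semidefinite terms. -/
theorem posSemidef_riccati {S : Plant ι κ} (hQ₀ : S.Q₀.PosSemidef) (hQ : S.Q.PosSemidef)
    (hR : S.R.PosDef) (t : ℕ) : (riccati S t).PosSemidef := by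
  induction t with
  | zero => exact hQ₀
  | succ t ih =>
    have hH := posDef_gain hR ih
    have hYt : (riccati S t)ᵀ = riccati S t := by
      simpa [Matrix.conjTranspose_eq_transpose_of_trivial] using ih.isHermitian.eq
    rw [riccati]
    set Y := riccati S t
    set G := S.Bᵀ * Y * S.B + S.R
    have hdet : IsUnit G.det := (Matrix.isUnit_iff_isUnit_det _).1 hH.isUnit
    have hGt : Gᵀ = G := by
      simpa [Matrix.conjTranspose_eq_transpose_of_trivial] using hH.isHermitian.eq
    set K := G⁻¹ * (S.Bᵀ * Y * S.A) with hK
    have hGK : G * K = S.Bᵀ * Y * S.A := by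
      rw [hK, ← Matrix.mul_assoc, Matrix.mul_nonsing_inv _ hdet, Matrix.one_mul]
    have h1 := ih.conjTranspose_mul_mul_same (S.A - S.B * K)
    have h2 := hR.posSemidef.conjTranspose_mul_mul_same K
    rw [Matrix.conjTranspose_eq_transpose_of_trivial] at h1 h2
    convert (h1.add hQ).add h2 using 1
    -- After expansion, the two forms of the iterate differ exactly by this identity.
    have key : Kᵀ * (G * K) = Kᵀ * (S.Bᵀ * Y * S.A) := by rw [hGK]
    simp only [G, Matrix.add_mul, Matrix.mul_add] at key
    simp only [Matrix.transpose_sub, Matrix.transpose_mul, Matrix.sub_mul, Matrix.mul_sub,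
      Matrix.mul_assoc] at key ⊢
    have e : S.Aᵀ * (Y * (S.B * (G⁻¹ * (S.Bᵀ * (Y * S.A))))) = S.Aᵀ * (Y * (S.B * K)) := by
      rw [hK, Matrix.mul_assoc S.Bᵀ]
    rw [e, ← sub_eq_zero]
    rw [← sub_eq_zero] at key
    rw [← neg_eq_zero, ← key]
    abel

theorem posSemidef_X {S : Plant ι κ} (hQ₀ : S.Q₀.PosSemidef) (hQ : S.Q.PosSemidef)
    (hR : S.R.PosDef) (k : ℕ) : (X S k).PosSemidef :=
  posSemidef_riccati hQ₀ hQ hR _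

theorem posDef_H {S : Plant ι κ} (hQ₀ : S.Q₀.PosSemidef) (hQ : S.Q.PosSemidef)
    (hR : S.R.PosDef) (k : ℕ) : (H S k).PosDef :=
  posDef_gain hR (posSemidef_X hQ₀ hQ hR _)

/-- Completion of squares in one step of the Riccati recursion. -/
theorem stage_cost_eq {S : Plant ι κ} (hQ₀ : S.Q₀.PosSemidef) (hQ : S.Q.PosSemidef)
    (hR : S.R.PosDef) {k : ℕ} (hk : k < S.N) (x : ι → ℝ) (u : κ → ℝ) :
    x ⬝ᵥ (S.Q *ᵥ x) + u ⬝ᵥ (S.R *ᵥ u)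
        + (S.A *ᵥ x + S.B *ᵥ u) ⬝ᵥ (X S (k + 1) *ᵥ (S.A *ᵥ x + S.B *ᵥ u))
      = x ⬝ᵥ (X S k *ᵥ x) + (u - L S k *ᵥ x) ⬝ᵥ (H S k *ᵥ (u - L S k *ᵥ x)) := by
  have hH := posDef_H hQ₀ hQ hR k
  have hdet : IsUnit (H S k).det := (Matrix.isUnit_iff_isUnit_det _).1 hH.isUnit
  have hX : (X S (k + 1))ᵀ = X S (k + 1) := by
    simpa [Matrix.conjTranspose_eq_transpose_of_trivial]
      using (posSemidef_X hQ₀ hQ hR (k + 1)).isHermitian.eq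
  have hHt : (H S k)ᵀ = H S k := by
    simpa [Matrix.conjTranspose_eq_transpose_of_trivial] using hH.isHermitian.eq
  have hHL : H S k * L S k = -(S.Bᵀ * X S (k + 1) * S.A) := by
    rw [L, Matrix.mul_neg, ← Matrix.mul_assoc, Matrix.mul_nonsing_inv _ hdet, Matrix.one_mul]
  have hXk : X S k = S.Aᵀ * X S (k + 1) * S.A + S.Q
      + (S.Aᵀ * X S (k + 1) * S.B) * L S k := by
    -- This is where `hk` enters: for k ≥ N the truncated subtraction would make no recursion step.
    have : S.N - k = S.N - (k + 1) + 1 := by omega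
    rw [X, this, riccati, L, Matrix.mul_neg, ← sub_eq_add_neg, Matrix.mul_assoc _ _⁻¹]
    rfl
  have hLHL : (L S k *ᵥ x) ⬝ᵥ (H S k *ᵥ (L S k *ᵥ x))
      = -(x ⬝ᵥ ((S.Aᵀ * X S (k + 1) * S.B * L S k) *ᵥ x)) := by
    rw [Matrix.mulVec_mulVec, hHL, dotProduct_comm, mulVec_dotProduct, Matrix.mulVec_mulVec]
    simp [Matrix.transpose_mul, hX, Matrix.neg_mulVec, Matrix.mul_assoc]
  have hcross : u ⬝ᵥ (H S k *ᵥ (L S k *ᵥ x))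
      = -((S.B *ᵥ u) ⬝ᵥ (X S (k + 1) *ᵥ (S.A *ᵥ x))) := by
    rw [Matrix.mulVec_mulVec, hHL, mulVec_dotProduct]
    simp [Matrix.neg_mulVec, Matrix.mul_assoc]
  have hHu : u ⬝ᵥ (H S k *ᵥ u)
      = (S.B *ᵥ u) ⬝ᵥ (X S (k + 1) *ᵥ (S.B *ᵥ u)) + u ⬝ᵥ (S.R *ᵥ u) := by
    rw [H, mulVec_dotProduct]
    simp [Matrix.add_mulVec, Matrix.mul_assoc]
  have hXx : x ⬝ᵥ (X S k *ᵥ x)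
      = (S.A *ᵥ x) ⬝ᵥ (X S (k + 1) *ᵥ (S.A *ᵥ x)) + x ⬝ᵥ (S.Q *ᵥ x)
        + x ⬝ᵥ ((S.Aᵀ * X S (k + 1) * S.B * L S k) *ᵥ x) := by
    rw [hXk, mulVec_dotProduct]
    simp [Matrix.add_mulVec, Matrix.mul_assoc]
  simp only [Matrix.mulVec_add, Matrix.mulVec_sub, add_dotProduct, dotProduct_add,
    sub_dotProduct, dotProduct_sub]
  rw [hXx, hLHL, hHu, hcross, dotProduct_mulVec_symm hHt (L S k *ᵥ x) u, hcross,
    dotProduct_mulVec_symm hX (S.A *ᵥ x) (S.B *ᵥ u)]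
  ring

end Riccati

/-! ### Linear functions of an initial segment of a process. -/

section LinearIn

variable {Ω ι α β : Type*}

/-- `v` is a linear function of `z 0, …, z (n - 1)`. -/
def LinearIn (z : ℕ → Ω → ι → ℝ) (n : ℕ) (v : Ω → α → ℝ) : Prop :=
  ∃ l : (Fin n → ι → ℝ) →ₗ[ℝ] (α → ℝ), ∀ ω, v ω = l (fun j => z j ω)

namespace LinearIn

variable {z z' : ℕ → Ω → ι → ℝ} {n m : ℕ} {v v' : Ω → α → ℝ}

theorem of_lt {j : ℕ} (hj : j < n) : LinearIn z n (z j) :=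
  ⟨LinearMap.proj ⟨j, hj⟩, fun _ => rfl⟩

theorem zero : LinearIn z n (0 : Ω → α → ℝ) := ⟨0, fun _ => rfl⟩

theorem add (h : LinearIn z n v) (h' : LinearIn z n v') :
    LinearIn z n (fun ω => v ω + v' ω) := by
  obtain ⟨l, hl⟩ := h
  obtain ⟨l', hl'⟩ := h'
  exact ⟨l + l', fun ω => by simp [hl, hl']⟩

theorem sub (h : LinearIn z n v) (h' : LinearIn z n v') :
    LinearIn z n (fun ω => v ω - v' ω) := by
  obtain ⟨l, hl⟩ := h
  obtain ⟨l', hl'⟩ := h'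
  exact ⟨l - l', fun ω => by simp [hl, hl']⟩

theorem mulVec [Fintype α] (h : LinearIn z n v) (C : Matrix β α ℝ) :
    LinearIn z n (fun ω => C *ᵥ v ω) := by
  obtain ⟨l, hl⟩ := h
  exact ⟨C.mulVecLin ∘ₗ l, fun ω => by simp [hl]⟩

theorem trans (h : LinearIn z' m v) (hz : ∀ j < m, LinearIn z n (z' j)) : LinearIn z n v := by
  obtain ⟨l, hl⟩ := h
  choose a ha using hz
  refine ⟨l ∘ₗ LinearMap.pi fun j : Fin m => a j j.2, fun ω => ?_⟩
  rw [hl]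
  simp only [LinearMap.comp_apply]
  congr 1
  funext j
  rw [LinearMap.pi_apply, ← ha]

theorem mono (h : LinearIn z m v) (hmn : m ≤ n) : LinearIn z n v :=
  h.trans fun _ hj => of_lt (hj.trans_le hmn)

variable [Fintype ι] [Fintype α]

theorem measurable {mΩ : MeasurableSpace Ω} (h : LinearIn z n v)
    (hz : ∀ j < n, Measurable (z j)) : Measurable v := by
  obtain ⟨l, hl⟩ := h
  rw [funext hl]
  exact l.continuous_of_finiteDimensional.measurable.comp
    (measurable_pi_lambda _ fun j => hz j j.2)

variable [MeasurableSpace Ω] {P : Measure Ω}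

theorem memLp (h : LinearIn z n v) (hz : ∀ j, MemLp (z j) 2 P) : MemLp v 2 P := by
  obtain ⟨l, hl⟩ := h
  rw [funext hl]
  exact (LinearMap.toContinuousLinearMap l).comp_memLp' (MemLp.of_eval fun j : Fin n => hz j)

theorem integral_eq_zero [IsFiniteMeasure P] (h : LinearIn z n v) (hz : ∀ j, MemLp (z j) 2 P)
    (hz0 : ∀ j, ∫ ω, z j ω ∂P = 0) : ∫ ω, v ω ∂P = 0 := by
  obtain ⟨l, hl⟩ := h
  have hi : ∀ j : Fin n, Integrable (z j) P := fun j => (hz j).integrable (by norm_num)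
  simp_rw [hl]
  have := (LinearMap.toContinuousLinearMap l).integral_comp_comm (Integrable.of_eval hi)
  simp only [LinearMap.coe_toContinuousLinearMap'] at this
  rw [this]
  convert map_zero l
  funext j
  rw [eval_integral hi, hz0]
  rfl

/-- The two vectors depend on disjoint blocks of an independent family, the indices below n and
those from n to n + m - 1. -/
theorem indepFun {γ : Type*} [Fintype γ] [IsProbabilityMeasure P] {e : Ω → γ → ℝ}
    (hz : ∀ j, Measurable (z j))
    (hind : iIndepFun z P) (hv : LinearIn z n v) (he : LinearIn (fun j => z (n + j)) m e) :
    IndepFun v e P := by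
  obtain ⟨l, hl⟩ := hv
  obtain ⟨l', hl'⟩ := he
  have hd : Disjoint (Finset.range n) (Finset.Ico n (n + m)) := by
    rw [Finset.disjoint_left]
    intro i hi hi'
    simp at hi hi'
    omega
  have := hind.indepFun_finset _ _ hd hz
  have h2 := this.comp
    (φ := fun y => l fun j : Fin n => y ⟨j, by simp⟩)
    (ψ := fun y => l' fun j : Fin m => y ⟨n + j, by simp⟩)
    (l.continuous_of_finiteDimensional.measurable.comp
      (measurable_pi_lambda _ fun _ => measurable_pi_apply _))
    (l'.continuous_of_finiteDimensional.measurable.comp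
      (measurable_pi_lambda _ fun _ => measurable_pi_apply _))
  rw [funext hl, funext hl']
  exact h2

end LinearIn

end LinearIn

/-! ### Vanishing of cross terms between independent vectors. -/

section Orthogonality

variable {Ω α β : Type*} [Fintype α] [Fintype β] [MeasurableSpace Ω] {P : Measure Ω}

theorem integrable_dotProduct_mulVec {a : Ω → α → ℝ} {b : Ω → β → ℝ} (ha : MemLp a 2 P)
    (hb : MemLp b 2 P) (C : Matrix α β ℝ) : Integrable (fun ω => a ω ⬝ᵥ (C *ᵥ b ω)) P := by
  simp only [dotProduct, Matrix.mulVec]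
  refine integrable_finsetSum _ fun i _ => ?_
  have h : MemLp (fun ω => ∑ j, C i j * b ω j) 2 P :=
    memLp_finsetSum _ fun j _ => (hb.eval j).const_mul _
  exact (ha.eval i).integrable_mul h

theorem integral_dotProduct_mulVec_eq_zero [IsFiniteMeasure P] {a : Ω → α → ℝ} {b : Ω → β → ℝ}
    (ha : MemLp a 2 P) (hb : MemLp b 2 P) (hab : IndepFun a b P) (hb0 : ∫ ω, b ω ∂P = 0)
    (C : Matrix α β ℝ) : ∫ ω, a ω ⬝ᵥ (C *ᵥ b ω) ∂P = 0 := by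
  have hb0' : ∀ j, ∫ ω, b ω j ∂P = 0 := fun j => by
    rw [← eval_integral fun j => (hb.eval j).integrable (by norm_num)]
    exact congrFun hb0 j
  have hint : ∀ i j, Integrable (fun ω => a ω i * (C i j * b ω j)) P := fun i j =>
    (ha.eval i).integrable_mul ((hb.eval j).const_mul _)
  simp only [dotProduct, Matrix.mulVec, Finset.mul_sum]
  rw [integral_finsetSum _ fun i _ => integrable_finsetSum _ fun j _ => hint i j]
  refine Finset.sum_eq_zero fun i _ => ?_
  rw [integral_finsetSum _ fun j _ => hint i j]
  refine Finset.sum_eq_zero fun j _ => ?_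
  have h := (hab.comp (measurable_pi_apply i) (measurable_pi_apply j)).integral_fun_mul_eq_mul_integral
    (ha.eval i).aestronglyMeasurable (hb.eval j).aestronglyMeasurable
  simp only [Function.comp_apply] at h
  calc ∫ ω, a ω i * (C i j * b ω j) ∂P = C i j * ∫ ω, a ω i * b ω j ∂P := by
        rw [← integral_const_mul]; congr 1; funext ω; ring
    _ = 0 := by rw [h, hb0', mul_zero, mul_zero]

end Orthogonality

/-! ### The innovation sequence x(0), w(0), w(1), …. -/

section Innovations

variable {Ω ι : Type*} [MeasurableSpace Ω] [Fintype ι] {P : Measure Ω}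
  {x₀ : Ω → ι → ℝ} {w : ℕ → Ω → ι → ℝ} {P₀ W : Matrix ι ι ℝ}

theorem IsDisturbance.measurable_noise1 (hw : IsDisturbance P x₀ w P₀ W) (k : ℕ) :
    Measurable (noise1 x₀ w k) := by
  cases k
  exacts [hw.measurable_init, hw.measurable_noise _]

theorem IsDisturbance.memLp_noise1 (hw : IsDisturbance P x₀ w P₀ W) (k : ℕ) :
    MemLp (noise1 x₀ w k) 2 P := by
  cases k
  exacts [hw.memLp_init, (hw.gaussian_noise _).memLp_two]

theorem IsDisturbance.integral_noise1 [IsFiniteMeasure P] (hw : IsDisturbance P x₀ w P₀ W) (k : ℕ) :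
    ∫ ω, noise1 x₀ w k ω ∂P = 0 := by
  funext i
  rw [eval_integral fun i => ((hw.memLp_noise1 k).eval i).integrable (by norm_num)]
  cases k
  exacts [hw.mean_init i, hw.mean_noise _ i]

/-- Index 0 is split off from the finite index set: the rest factors by independence of the noise,
and x(0) is independent of the whole noise path. -/
theorem IsDisturbance.iIndepFun_noise1 [IsProbabilityMeasure P] (hw : IsDisturbance P x₀ w P₀ W) :
    iIndepFun (noise1 x₀ w) P := by
  classical
  rw [iIndepFun_iff_measure_inter_preimage_eq_mul]
  intro T s hs
  obtain ⟨U, hU⟩ : ∃ U : Finset ℕ, T.erase 0 = U.image Nat.succ := by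
    refine ⟨(T.erase 0).image Nat.pred, ?_⟩
    rw [Finset.image_image]
    refine ((Finset.image_congr fun k hk => ?_).trans Finset.image_id).symm
    exact Nat.succ_pred (Finset.ne_of_mem_erase hk)
  have hs' : ∀ k ∈ U, MeasurableSet (s (k + 1)) := fun k hk =>
    hs _ (Finset.mem_of_mem_erase (hU ▸ Finset.mem_image_of_mem _ hk))
  have hnoise : P (⋂ k ∈ T.erase 0, noise1 x₀ w k ⁻¹' s k)
      = ∏ k ∈ T.erase 0, P (noise1 x₀ w k ⁻¹' s k) := by
    rw [hU, Finset.prod_image Nat.succ_injective.injOn, Finset.set_biInter_finset_image]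
    exact hw.indep_noise.measure_inter_preimage_eq_mul U hs'
  by_cases h0 : 0 ∈ T
  · rw [← Finset.insert_erase h0, Finset.prod_insert (Finset.notMem_erase _ _),
      Finset.set_biInter_insert, ← hnoise, hU, Finset.set_biInter_finset_image]
    have hm : MeasurableSet (⋂ k ∈ U, (fun y : ℕ → ι → ℝ => y k) ⁻¹' s (k + 1)) :=
      Finset.measurableSet_biInter _ fun k hk => measurable_pi_apply k (hs' k hk)
    have := hw.indep_init.measure_inter_preimage_eq_mul _ _ (hs 0 h0) hm
    simp only [Set.preimage_iInter] at this
    exact this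
  · rwa [Finset.erase_eq_of_notMem h0] at hnoise

end Innovations

/-! ### Closed-loop signals in terms of innovations and of states. -/

section ClosedLoop

variable {Ω ι κ : Type*}

theorem noise2_linearIn (x₀ : Ω → ι → ℝ) (w : ℕ → Ω → ι → ℝ) (k : ℕ) :
    LinearIn (noise1 x₀ w) k (noise2 x₀ w k) := by
  cases k with
  | zero => exact LinearIn.zero
  | succ k => exact LinearIn.of_lt k.lt_succ_self

theorem u1_linearIn [Fintype ι] (x₀ : Ω → ι → ℝ) (w : ℕ → Ω → ι → ℝ) (F M : ℕ → Matrix κ ι ℝ) (k : ℕ) :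
    LinearIn (noise1 x₀ w) (k + 1) (u1 x₀ w F M k) :=
  ((LinearIn.of_lt k.lt_succ_self).mulVec (F k)).add
    (((noise2_linearIn x₀ w k).mono k.le_succ).mulVec (M k))

/-- The window k-1, k lies just beyond the innovations available to u²(k). At k = 0 truncation makes
it start at x(0), which is harmless as w(-2) = 0. -/
theorem noise2_linearIn_innovations (x₀ : Ω → ι → ℝ) (w : ℕ → Ω → ι → ℝ) (k : ℕ) :
    LinearIn (fun j => noise1 x₀ w (k - 1 + j)) 2 (noise2 x₀ w k) := by
  cases k with
  | zero => exact LinearIn.zero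
  | succ k => exact LinearIn.of_lt (z := fun j => noise1 x₀ w (k + j)) (j := 0) Nat.two_pos

theorem noise1_linearIn_innovations (x₀ : Ω → ι → ℝ) (w : ℕ → Ω → ι → ℝ) (k : ℕ) :
    LinearIn (fun j => noise1 x₀ w (k - 1 + j)) 2 (noise1 x₀ w k) := by
  cases k with
  | zero => exact LinearIn.of_lt (z := fun j => noise1 x₀ w (0 - 1 + j)) (j := 0) Nat.two_pos
  | succ k => exact LinearIn.of_lt (z := fun j => noise1 x₀ w (k + j)) (j := 1) Nat.one_lt_two

theorem u1_linearIn_innovations [Fintype ι] (x₀ : Ω → ι → ℝ) (w : ℕ → Ω → ι → ℝ)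
    (F M : ℕ → Matrix κ ι ℝ) (k : ℕ) :
    LinearIn (fun j => noise1 x₀ w (k - 1 + j)) 2 (u1 x₀ w F M k) :=
  ((noise1_linearIn_innovations x₀ w k).mulVec _).add
    ((noise2_linearIn_innovations x₀ w k).mulVec _)

variable [Fintype ι] [Fintype κ]

variable (S : Plant ι κ) (x₀ : Ω → ι → ℝ) (w : ℕ → Ω → ι → ℝ) (F M : ℕ → Matrix κ ι ℝ)
  (f : CommonPolicy ι κ)

theorem u2_linearIn_state (k : ℕ) :
    LinearIn (state S x₀ w F M f) (k - 1) (u2 S x₀ w F M f k) := ⟨f k, fun _ => rfl⟩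

theorem state_linearIn (k : ℕ) : LinearIn (noise1 x₀ w) (k + 1) (state S x₀ w F M f k) := by
  induction k using Nat.strong_induction_on with
  | _ k ih =>
    cases k with
    | zero =>
      have : state S x₀ w F M f 0 = noise1 x₀ w 0 := by rw [state]; rfl
      rw [this]
      exact LinearIn.of_lt Nat.one_pos
    | succ k =>
      have hu2 : LinearIn (noise1 x₀ w) (k + 2) (u2 S x₀ w F M f k) :=
        (u2_linearIn_state S x₀ w F M f k).trans fun j hj => (ih j (by omega)).mono (by omega)
      have := ((((ih k k.lt_succ_self).mono (Nat.le_succ _)).mulVec S.A).add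
        ((((u1_linearIn x₀ w F M k).mono (Nat.le_succ _)).add hu2).mulVec S.B)).add
        (LinearIn.of_lt (z := noise1 x₀ w) (k + 1).lt_succ_self)
      rw [funext (state_succ S x₀ w F M f k)]
      exact this

theorem u2_linearIn (k : ℕ) : LinearIn (noise1 x₀ w) (k - 1) (u2 S x₀ w F M f k) :=
  (u2_linearIn_state S x₀ w F M f k).trans fun j hj =>
    (state_linearIn S x₀ w F M f j).mono (by omega)

theorem control_linearIn (k : ℕ) :
    LinearIn (noise1 x₀ w) (k + 1) (control S x₀ w F M f k) :=
  (u1_linearIn x₀ w F M k).add ((u2_linearIn S x₀ w F M f k).mono (by omega))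

/-- The disturbance is recovered from w(k) = x(k+1) - Ax(k) - Bu(k), where u(k) is already known to
be linear in earlier states. -/
theorem noise1_linearIn_state (k : ℕ) :
    LinearIn (state S x₀ w F M f) (k + 1) (noise1 x₀ w k) := by
  induction k using Nat.strong_induction_on with
  | _ k ih =>
    cases k with
    | zero =>
      have : noise1 x₀ w 0 = state S x₀ w F M f 0 := by rw [state]; rfl
      rw [this]
      exact LinearIn.of_lt Nat.one_pos
    | succ k =>
      have hu : LinearIn (state S x₀ w F M f) (k + 1 + 1) (control S x₀ w F M f k) :=
        ((u1_linearIn x₀ w F M k).trans fun j hj => (ih j hj).mono (by omega)).add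
          ((u2_linearIn_state S x₀ w F M f k).mono (by omega))
      have := ((LinearIn.of_lt (z := state S x₀ w F M f) (k + 1).lt_succ_self).sub
        ((LinearIn.of_lt (z := state S x₀ w F M f) (show k < k + 1 + 1 by omega)).mulVec S.A)).sub
        (hu.mulVec S.B)
      convert this using 1
      funext ω
      rw [state_succ]
      change w k ω = _
      abel

theorem control_linearIn_state (k : ℕ) :
    LinearIn (state S x₀ w F M f) (k + 1) (control S x₀ w F M f k) :=
  ((u1_linearIn x₀ w F M k).trans fun j hj =>
    (noise1_linearIn_state S x₀ w F M f j).mono (by omega)).add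
      ((u2_linearIn_state S x₀ w F M f k).mono (by omega))

/-- The part `(A + B F(k-1)) w(k-2) + w(k-1)` of `x(k)` that is independent of `x(0:k-2)`. -/
def predictionError (S : Plant ι κ) (x₀ : Ω → ι → ℝ) (w : ℕ → Ω → ι → ℝ) (F : ℕ → Matrix κ ι ℝ)
    (k : ℕ) (ω : Ω) : ι → ℝ :=
  (S.A + S.B * F (k - 1)) *ᵥ noise2 x₀ w k ω + noise1 x₀ w k ω

/-- The part of `x(k)` that is a function of `x(0:k-2)`. -/
def prediction (S : Plant ι κ) (x₀ : Ω → ι → ℝ) (w : ℕ → Ω → ι → ℝ) (F M : ℕ → Matrix κ ι ℝ)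
    (f : CommonPolicy ι κ) (k : ℕ) (ω : Ω) : ι → ℝ :=
  state S x₀ w F M f k ω - predictionError S x₀ w F k ω

theorem predictionError_linearIn (k : ℕ) :
    LinearIn (fun j => noise1 x₀ w (k - 1 + j)) 2 (predictionError S x₀ w F k) :=
  ((noise2_linearIn_innovations x₀ w k).mulVec _).add (noise1_linearIn_innovations x₀ w k)

/-- Unrolling two steps, what remains after removing the error is A(Ax(k-2) + Bu(k-2)) +
B(M(k-1)w(k-3) + u²(k-1)). Here w(k-3) is recoverable from x(0:k-2). For k = 0, 1 nothing remains.
-/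
theorem prediction_linearIn_state (k : ℕ) :
    LinearIn (state S x₀ w F M f) (k - 1) (prediction S x₀ w F M f k) := by
  match k with
  | 0 =>
    convert LinearIn.zero using 1
    funext ω
    simp [prediction, predictionError, noise1, noise2, state]
  | 1 =>
    convert LinearIn.zero using 1
    funext ω
    -- The domain is indexed by the empty type `Fin (0 - 1)`, so it has only the zero vector.
    have h0 : f 0 = 0 := LinearMap.ext fun y => by
      rw [show y = 0 from funext fun j => j.elim0, map_zero, map_zero]
    simp only [prediction, predictionError, state_succ, control, u1, u2, noise1, noise2, h0]
    simp [state, Matrix.add_mulVec, Matrix.mulVec_mulVec]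
  | m + 2 =>
    have h := (((LinearIn.of_lt (z := state S x₀ w F M f) m.lt_add_one).mulVec S.A).add
      ((control_linearIn_state S x₀ w F M f m).mulVec S.B)).mulVec S.A
    have h' := (((noise1_linearIn_state S x₀ w F M f m).mulVec (M (m + 1))).add
      ((u2_linearIn_state S x₀ w F M f (m + 1)).mono m.le_succ)).mulVec S.B
    have hsum : LinearIn (state S x₀ w F M f) (m + 2 - 1) _ := h.add h'
    convert hsum using 1
    funext ω
    simp only [prediction, predictionError, state_succ S x₀ w F M f (m + 1)]
    rw [state_succ S x₀ w F M f m, control.eq_def S x₀ w F M f (m + 1)]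
    simp only [u1, noise1, noise2, Matrix.mulVec_add, Matrix.add_mulVec, Matrix.mulVec_mulVec]
    simp only [Nat.add_one_sub_one]
    abel

theorem prediction_linearIn (k : ℕ) :
    LinearIn (noise1 x₀ w) (k - 1) (prediction S x₀ w F M f k) :=
  (prediction_linearIn_state S x₀ w F M f k).trans fun j hj =>
    (state_linearIn S x₀ w F M f j).mono (by omega)

variable {f}

/-- Causality, which is what permits building a policy one time step at a time. -/
theorem state_congr {g : CommonPolicy ι κ} {k : ℕ} (h : ∀ i < k, f i = g i) :
    state S x₀ w F M f k = state S x₀ w F M g k := by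
  induction k using Nat.strong_induction_on with
  | _ k ih =>
    cases k with
    | zero => rw [state, state]
    | succ k =>
      have ih' : ∀ j ≤ k, state S x₀ w F M f j = state S x₀ w F M g j := fun j hj =>
        ih j (by omega) fun i hi => h i (by omega)
      funext ω
      rw [state, state, ih' k le_rfl, h k k.lt_succ_self]
      have : ∀ j : Fin (k - 1), state S x₀ w F M f j = state S x₀ w F M g j := fun j =>
        ih' j (by omega)
      simp only [this]

theorem u2_congr {g : CommonPolicy ι κ} {k : ℕ} (h : ∀ i ≤ k, f i = g i) :
    u2 S x₀ w F M f k = u2 S x₀ w F M g k := by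
  have : ∀ j : Fin (k - 1), state S x₀ w F M f j = state S x₀ w F M g j := fun j =>
    state_congr S x₀ w F M fun i hi => h i (by omega)
  funext ω
  simp only [u2, this, h k le_rfl]

theorem prediction_congr {g : CommonPolicy ι κ} {k : ℕ} (h : ∀ i < k, f i = g i) :
    prediction S x₀ w F M f k = prediction S x₀ w F M g k := by
  funext ω
  rw [prediction, prediction, state_congr S x₀ w F M h]

theorem exists_policy_u2_eq (K : ℕ → Matrix κ ι ℝ) (n : ℕ) : ∃ f : CommonPolicy ι κ, ∀ k < n,
    u2 S x₀ w F M f k = fun ω => K k *ᵥ prediction S x₀ w F M f k ω := by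
  induction n with
  | zero => exact ⟨fun _ => 0, by simp⟩
  | succ n ih =>
    obtain ⟨f, hf⟩ := ih
    -- Installing `l` as the rule at time n changes neither the earlier inputs nor the prediction at
    -- time n, so the representation stays valid for the new policy.
    obtain ⟨l, hl⟩ := (prediction_linearIn_state S x₀ w F M f n).mulVec (K n)
    have hne : ∀ i < n, Function.update f n l i = f i := fun i hi =>
      Function.update_of_ne hi.ne _ _
    refine ⟨Function.update f n l, fun k hk => ?_⟩
    rcases (Nat.lt_succ_iff.1 hk).lt_or_eq with hk | rfl
    · rw [u2_congr S x₀ w F M fun i hi => hne i (by omega),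
        prediction_congr S x₀ w F M fun i hi => hne i (by omega), hf k hk]
    · rw [prediction_congr S x₀ w F M hne]
      funext ω
      refine Eq.trans ?_ (hl ω).symm
      rw [u2, Function.update_self]
      have : ∀ j : Fin (k - 1), state S x₀ w F M (Function.update f k l) j
          = state S x₀ w F M f j := fun j =>
        state_congr S x₀ w F M fun i hi => hne i (by omega)
      simp only [this]

end ClosedLoop

/-! ### Lower bound for J²_u and its attainment. -/

section CommonCost

variable {Ω ι κ : Type*} [Fintype ι] [Fintype κ] [DecidableEq κ] [MeasurableSpace Ω]
  {P : Measure Ω} {x₀ : Ω → ι → ℝ} {w : ℕ → Ω → ι → ℝ}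

theorem J2_nonneg {S : Plant ι κ} (hQ₀ : S.Q₀.PosSemidef)
    (hQ : S.Q.PosSemidef) (hR : S.R.PosDef) (F M : ℕ → Matrix κ ι ℝ) (f : CommonPolicy ι κ) :
    0 ≤ J2 P S x₀ w F M f :=
  Finset.sum_nonneg fun k _ => integral_nonneg fun _ =>
    dotProduct_mulVec_nonneg (posDef_H hQ₀ hQ hR k).posSemidef _

theorem J2_eq_zero {S : Plant ι κ} {F M : ℕ → Matrix κ ι ℝ} {f : CommonPolicy ι κ}
    (hf : ∀ k < S.N, u2 S x₀ w F M f k =ᵐ[P] fun ω => L S k *ᵥ x2 P S x₀ w F M f k ω) :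
    J2 P S x₀ w F M f = 0 := by
  refine Finset.sum_eq_zero fun k hk => integral_eq_zero_of_ae ?_
  filter_upwards [hf k (Finset.mem_range.1 hk)] with ω h
  simp [h]

end CommonCost

/-! ### The conditional mean and the decomposition of J. -/

section Cost

variable {Ω ι κ : Type*} [Fintype ι] [Fintype κ] [MeasurableSpace Ω] {P : Measure Ω}
  [IsProbabilityMeasure P] {x₀ : Ω → ι → ℝ} {w : ℕ → Ω → ι → ℝ} {P₀ W : Matrix ι ι ℝ}

theorem x2_ae_eq_prediction (hw : IsDisturbance P x₀ w P₀ W) (S : Plant ι κ)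
    (F M : ℕ → Matrix κ ι ℝ) (f : CommonPolicy ι κ) (k : ℕ) :
    x2 P S x₀ w F M f k =ᵐ[P] prediction S x₀ w F M f k := by
  have hxm : ∀ j, Measurable (state S x₀ w F M f j) := fun j =>
    (state_linearIn S x₀ w F M f j).measurable fun i _ => hw.measurable_noise1 i
  have hle : commonInfo (state S x₀ w F M f) k ≤ ‹MeasurableSpace Ω› :=
    iSup_le fun j => (hxm j).comap_le
  have herr := predictionError_linearIn S x₀ w F k
  have herrm : Measurable (predictionError S x₀ w F k) :=
    herr.measurable fun j _ => hw.measurable_noise1 _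
  have hpred := prediction_linearIn S x₀ w F M f k
  have hpm : Measurable[commonInfo (state S x₀ w F M f) k] (prediction S x₀ w F M f k) :=
    (prediction_linearIn_state S x₀ w F M f k).measurable fun j hj =>
      (comap_measurable _).mono (le_iSup (fun i : Fin (k - 1) =>
        MeasurableSpace.comap (state S x₀ w F M f i) inferInstance) ⟨j, hj⟩) le_rfl
  have hpint : Integrable (prediction S x₀ w F M f k) P :=
    (hpred.memLp hw.memLp_noise1).integrable (by norm_num)
  have heint : Integrable (predictionError S x₀ w F k) P :=
    (herr.memLp fun j => hw.memLp_noise1 _).integrable (by norm_num)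
  have hindep : Indep (MeasurableSpace.comap (predictionError S x₀ w F k) inferInstance)
      (commonInfo (state S x₀ w F M f) k) P := by
    -- All of x(0:k-2) is stacked into one vector, whose σ-algebra contains `commonInfo`; its
    -- independence from the error then suffices.
    let y : Ω → Fin (k - 1) × ι → ℝ := fun ω p => state S x₀ w F M f p.1 ω p.2
    have hy : LinearIn (state S x₀ w F M f) (k - 1) y :=
      ⟨LinearMap.pi fun p => LinearMap.proj p.2 ∘ₗ LinearMap.proj p.1, fun _ => rfl⟩
    have hy' : LinearIn (noise1 x₀ w) (k - 1) y := hy.trans fun j hj =>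
      (state_linearIn S x₀ w F M f j).mono (by omega)
    have hi := (hy'.indepFun hw.measurable_noise1 hw.iIndepFun_noise1 herr).symm
    refine indep_of_indep_of_le_right hi (iSup_le fun j => ?_)
    have hj : Measurable fun (v : Fin (k - 1) × ι → ℝ) (i : ι) => v (j, i) :=
      measurable_pi_lambda _ fun _ => measurable_pi_apply _
    exact (hj.comp (comap_measurable y)).comap_le
  have hsum : state S x₀ w F M f k
      = prediction S x₀ w F M f k + predictionError S x₀ w F k := by
    funext ω
    simp [prediction]
  have he0 := condExp_indep_eq herrm.comap_le hle (comap_measurable _).stronglyMeasurable hindep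
  have hadd := condExp_add hpint heint (commonInfo (state S x₀ w F M f) k)
  rw [condExp_of_stronglyMeasurable hle hpm.stronglyMeasurable hpint] at hadd
  rw [x2]
  conv_lhs => rw [hsum]
  filter_upwards [hadd, he0] with ω h1 h2
  rw [h1, Pi.add_apply, h2, herr.integral_eq_zero (fun j => hw.memLp_noise1 _)
    fun j => hw.integral_noise1 _, add_zero]

/-- The expected square of a sum of independent vectors, one of them centred. -/
theorem integral_quadratic_add {α : Type*} [Fintype α] {a b : Ω → α → ℝ} (ha : MemLp a 2 P)
    (hb : MemLp b 2 P) (hab : IndepFun a b P) (hb0 : ∫ ω, b ω ∂P = 0) {C : Matrix α α ℝ}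
    (hC : Cᵀ = C) :
    ∫ ω, (a ω + b ω) ⬝ᵥ (C *ᵥ (a ω + b ω)) ∂P
      = ∫ ω, a ω ⬝ᵥ (C *ᵥ a ω) ∂P + ∫ ω, b ω ⬝ᵥ (C *ᵥ b ω) ∂P := by
  have h : ∀ ω, (a ω + b ω) ⬝ᵥ (C *ᵥ (a ω + b ω))
      = a ω ⬝ᵥ (C *ᵥ a ω) + b ω ⬝ᵥ (C *ᵥ b ω) + 2 * (a ω ⬝ᵥ (C *ᵥ b ω)) := fun ω => by
    rw [Matrix.mulVec_add, add_dotProduct, dotProduct_add, dotProduct_add,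
      dotProduct_mulVec_symm hC (b ω) (a ω)]
    ring
  have haa := integrable_dotProduct_mulVec ha ha C
  have hbb := integrable_dotProduct_mulVec hb hb C
  simp_rw [h]
  rw [integral_add (haa.fun_add hbb) ((integrable_dotProduct_mulVec ha hb C).const_mul 2),
    integral_add haa hbb, integral_const_mul,
    integral_dotProduct_mulVec_eq_zero ha hb hab hb0, mul_zero, add_zero]

variable [DecidableEq κ]

/-- The part of `J` that no choice of the common component can influence. -/
noncomputable def uncontrollableCost (P : Measure Ω) (S : Plant ι κ) (x₀ : Ω → ι → ℝ)
    (w : ℕ → Ω → ι → ℝ) (F M : ℕ → Matrix κ ι ℝ) : ℝ :=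
  ∫ ω, x₀ ω ⬝ᵥ (X S 0 *ᵥ x₀ ω) ∂P + ∑ k ∈ Finset.range S.N,
    (∫ ω, w k ω ⬝ᵥ (X S (k + 1) *ᵥ w k ω) ∂P
      + ∫ ω, (u1 x₀ w F M k ω - L S k *ᵥ predictionError S x₀ w F k ω) ⬝ᵥ
          (H S k *ᵥ (u1 x₀ w F M k ω - L S k *ᵥ predictionError S x₀ w F k ω)) ∂P)

/-- With V(k) = E{x(k)ᵀX(k)x(k)}, each stage cost is V(k) - V(k+1) plus a noise term, a local term
and a common term; the V differences telescope. -/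
theorem J_eq (hw : IsDisturbance P x₀ w P₀ W) {S : Plant ι κ} (hQ₀ : S.Q₀.PosSemidef)
    (hQ : S.Q.PosSemidef) (hR : S.R.PosDef) (F M : ℕ → Matrix κ ι ℝ) (f : CommonPolicy ι κ) :
    J P S x₀ w F M f = uncontrollableCost P S x₀ w F M + J2 P S x₀ w F M f := by
  have hx : ∀ k, MemLp (state S x₀ w F M f k) 2 P := fun k =>
    (state_linearIn S x₀ w F M f k).memLp hw.memLp_noise1
  have hu : ∀ k, MemLp (control S x₀ w F M f k) 2 P := fun k =>
    (control_linearIn S x₀ w F M f k).memLp hw.memLp_noise1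
  set V : ℕ → ℝ := fun k => ∫ ω, state S x₀ w F M f k ω ⬝ᵥ (X S k *ᵥ state S x₀ w F M f k ω) ∂P
    with hV
  have step : ∀ k ∈ Finset.range S.N,
      ∫ ω, (state S x₀ w F M f k ω ⬝ᵥ (S.Q *ᵥ state S x₀ w F M f k ω)
          + control S x₀ w F M f k ω ⬝ᵥ (S.R *ᵥ control S x₀ w F M f k ω)) ∂P
        = (V k - V (k + 1))
          + ((∫ ω, w k ω ⬝ᵥ (X S (k + 1) *ᵥ w k ω) ∂P
            + ∫ ω, (u1 x₀ w F M k ω - L S k *ᵥ predictionError S x₀ w F k ω) ⬝ᵥ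
              (H S k *ᵥ (u1 x₀ w F M k ω - L S k *ᵥ predictionError S x₀ w F k ω)) ∂P)
            + ∫ ω, (u2 S x₀ w F M f k ω - L S k *ᵥ x2 P S x₀ w F M f k ω) ⬝ᵥ
              (H S k *ᵥ (u2 S x₀ w F M f k ω - L S k *ᵥ x2 P S x₀ w F M f k ω)) ∂P) := by
    intro k hk
    have hXt : (X S (k + 1))ᵀ = X S (k + 1) := by
      simpa [Matrix.conjTranspose_eq_transpose_of_trivial]
        using (posSemidef_X hQ₀ hQ hR (k + 1)).isHermitian.eq
    have hHt : (H S k)ᵀ = H S k := by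
      simpa [Matrix.conjTranspose_eq_transpose_of_trivial]
        using (posDef_H hQ₀ hQ hR k).isHermitian.eq
    have hz : LinearIn (noise1 x₀ w) (k + 1) (fun ω => S.A *ᵥ state S x₀ w F M f k ω
        + S.B *ᵥ control S x₀ w F M f k ω) :=
      ((state_linearIn S x₀ w F M f k).mulVec S.A).add
        ((control_linearIn S x₀ w F M f k).mulVec S.B)
    have hwk : LinearIn (fun j => noise1 x₀ w (k + 1 + j)) 1 (w k) :=
      LinearIn.of_lt (z := fun j => noise1 x₀ w (k + 1 + j)) (j := 0) Nat.one_pos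
    -- Here w(k) is innovation k+1, independent of Ax(k) + Bu(k), which uses only innovations 0 to
    -- k.
    have hnext : V (k + 1) = ∫ ω, (S.A *ᵥ state S x₀ w F M f k ω
          + S.B *ᵥ control S x₀ w F M f k ω) ⬝ᵥ (X S (k + 1) *ᵥ (S.A *ᵥ state S x₀ w F M f k ω
          + S.B *ᵥ control S x₀ w F M f k ω)) ∂P + ∫ ω, w k ω ⬝ᵥ (X S (k + 1) *ᵥ w k ω) ∂P := by
      simp only [hV, state_succ]
      exact integral_quadratic_add (hz.memLp hw.memLp_noise1) (hw.memLp_noise1 (k + 1))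
        (hz.indepFun hw.measurable_noise1 hw.iIndepFun_noise1 hwk) (hw.integral_noise1 (k + 1)) hXt
    have hv : LinearIn (noise1 x₀ w) (k - 1) (fun ω => u2 S x₀ w F M f k ω
        - L S k *ᵥ prediction S x₀ w F M f k ω) :=
      (u2_linearIn S x₀ w F M f k).sub ((prediction_linearIn S x₀ w F M f k).mulVec _)
    have hd : LinearIn (fun j => noise1 x₀ w (k - 1 + j)) 2 (fun ω => u1 x₀ w F M k ω
        - L S k *ᵥ predictionError S x₀ w F k ω) :=
      (u1_linearIn_innovations x₀ w F M k).sub ((predictionError_linearIn S x₀ w F k).mulVec _)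
    have hx2 : ∫ ω, (u2 S x₀ w F M f k ω - L S k *ᵥ x2 P S x₀ w F M f k ω) ⬝ᵥ
          (H S k *ᵥ (u2 S x₀ w F M f k ω - L S k *ᵥ x2 P S x₀ w F M f k ω)) ∂P
        = ∫ ω, (u2 S x₀ w F M f k ω - L S k *ᵥ prediction S x₀ w F M f k ω) ⬝ᵥ
          (H S k *ᵥ (u2 S x₀ w F M f k ω - L S k *ᵥ prediction S x₀ w F M f k ω)) ∂P := by
      refine integral_congr_ae ?_
      filter_upwards [x2_ae_eq_prediction hw S F M f k] with ω h
      rw [h]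
    -- The first summand uses innovations below k-1, the second the two-entry window from k-1, so
    -- their squares add in expectation.
    have hsplit : ∀ ω, control S x₀ w F M f k ω - L S k *ᵥ state S x₀ w F M f k ω
        = (u2 S x₀ w F M f k ω - L S k *ᵥ prediction S x₀ w F M f k ω)
          + (u1 x₀ w F M k ω - L S k *ᵥ predictionError S x₀ w F k ω) := fun ω => by
      rw [control, prediction, Matrix.mulVec_sub]
      abel
    have hcontrol := integral_quadratic_add (hv.memLp hw.memLp_noise1)
      (hd.memLp fun j => hw.memLp_noise1 _)
      (hv.indepFun hw.measurable_noise1 hw.iIndepFun_noise1 hd)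
      (hd.integral_eq_zero (fun j => hw.memLp_noise1 _) fun j => hw.integral_noise1 _) hHt
    simp_rw [← hsplit] at hcontrol
    have hzm := hz.memLp hw.memLp_noise1
    have hdev : MemLp (fun ω => control S x₀ w F M f k ω - L S k *ᵥ state S x₀ w F M f k ω) 2 P :=
      ((control_linearIn S x₀ w F M f k).sub
        ((state_linearIn S x₀ w F M f k).mulVec _)).memLp hw.memLp_noise1
    have hstage := integral_congr_ae (μ := P) (Filter.Eventually.of_forall fun ω =>
      stage_cost_eq hQ₀ hQ hR (Finset.mem_range.1 hk) (state S x₀ w F M f k ω)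
        (control S x₀ w F M f k ω))
    rw [integral_add ((integrable_dotProduct_mulVec (hx k) (hx k) _).fun_add
      (integrable_dotProduct_mulVec (hu k) (hu k) _)) (integrable_dotProduct_mulVec hzm hzm _),
      integral_add (integrable_dotProduct_mulVec (hx k) (hx k) _)
      (integrable_dotProduct_mulVec hdev hdev _), hcontrol] at hstage
    rw [hx2]
    have hVk : V k = ∫ ω, state S x₀ w F M f k ω ⬝ᵥ (X S k *ᵥ state S x₀ w F M f k ω) ∂P := rfl
    linarith
  have hV0 : V 0 = ∫ ω, x₀ ω ⬝ᵥ (X S 0 *ᵥ x₀ ω) ∂P := by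
    simp only [hV]
    rw [state]
  have hVN : V S.N = ∫ ω, state S x₀ w F M f S.N ω ⬝ᵥ (S.Q₀ *ᵥ state S x₀ w F M f S.N ω) ∂P := by
    have : X S S.N = S.Q₀ := by rw [X, Nat.sub_self, riccati]
    simp only [hV, this]
  rw [J, Finset.sum_congr rfl step, Finset.sum_add_distrib, Finset.sum_range_sub',
    Finset.sum_add_distrib, uncontrollableCost, J2, hV0, hVN]
  ring

end Cost

end DelayedLQR

theorem theorem2 {Ω : Type*} [MeasurableSpace Ω] (P : Measure Ω) [IsProbabilityMeasure P]
    {ι κ : Type*} [Fintype ι] [Fintype κ] [DecidableEq κ]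
    (S : DelayedLQR.Plant ι κ) (P₀ W : Matrix ι ι ℝ)
    (x₀ : Ω → ι → ℝ) (w : ℕ → Ω → ι → ℝ)
    (hw : DelayedLQR.IsDisturbance P x₀ w P₀ W)
    (hQ₀ : S.Q₀.PosSemidef) (hQ : S.Q.PosSemidef) (hR : S.R.PosDef)
    (F M : ℕ → Matrix κ ι ℝ) :
    -- some linear policy realizes `u²(k) = L(k) x²(k)`
    (∃ f : DelayedLQR.CommonPolicy ι κ, ∀ k < S.N,
      DelayedLQR.u2 S x₀ w F M f k
        =ᵐ[P] fun ω => DelayedLQR.L S k *ᵥ DelayedLQR.x2 P S x₀ w F M f k ω) ∧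
    -- any such policy minimizes `J²_u`, and also the total LQR cost, among all linear policies
    -- with the same `u¹`; for `F = M = 0` the latter is the centralized two-step-delay LQR problem
    (∀ f : DelayedLQR.CommonPolicy ι κ,
      (∀ k < S.N, DelayedLQR.u2 S x₀ w F M f k
        =ᵐ[P] fun ω => DelayedLQR.L S k *ᵥ DelayedLQR.x2 P S x₀ w F M f k ω) →
      (∀ g : DelayedLQR.CommonPolicy ι κ,
        DelayedLQR.J2 P S x₀ w F M f ≤ DelayedLQR.J2 P S x₀ w F M g) ∧
      (∀ g : DelayedLQR.CommonPolicy ι κ,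
        DelayedLQR.J P S x₀ w F M f ≤ DelayedLQR.J P S x₀ w F M g)) := by
  refine ⟨?_, fun f hf => ?_⟩
  · obtain ⟨f, hf⟩ := DelayedLQR.exists_policy_u2_eq S x₀ w F M (DelayedLQR.L S) S.N
    refine ⟨f, fun k hk => ?_⟩
    filter_upwards [DelayedLQR.x2_ae_eq_prediction hw S F M f k] with ω h
    rw [hf k hk, h]
  · have h2 : ∀ g : DelayedLQR.CommonPolicy ι κ,
        DelayedLQR.J2 P S x₀ w F M f ≤ DelayedLQR.J2 P S x₀ w F M g := fun g => by
      rw [DelayedLQR.J2_eq_zero hf]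
      exact DelayedLQR.J2_nonneg hQ₀ hQ hR F M g
    refine ⟨h2, fun g => ?_⟩
    rw [DelayedLQR.J_eq hw hQ₀ hQ hR, DelayedLQR.J_eq hw hQ₀ hQ hR]
    exact add_le_add_right (h2 g) _
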